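/- Let $(a_{ij})_{1\le i,j\le l}$ be a symmetrizable generalized Cartan matrix: $a_{ii}=2$, $a_{ij}$ is a nonpositive integer for $i\ne j$, $a_{ij}=0$ implies $a_{ji}=0$, and there are coprime positive integers $d_1,\dots,d_l$ such that the matrix $b_{ij}=a_{ij}d_i$ is symmetric. Let $q\in\mathbb C$ with $0<|q|<1$, and put $q_i=q^{d_i}$. Formal power series are infinite in all directions, i.e. arbitrary families of complex coefficients indexed by the (integer) exponents of monomials. The product of finitely many such series $f_1,\dots,f_N$ is said to exist if for every exponent $p$ the series $\sum_{e_1+\dots+e_N=p}(f_1)_{e_1}\cdots (f_N)_{e_N}$ converges independently of the ordering of its terms; its sum is then the coefficient of the product at $p$. We write $\frac1{1-x}=\sum_{n\ge0}x^n$. Let $F_{ij}(z)=\sum_{m\in\mathbb Z}(F_{ij})_mz^m$, $1\le i,j\le l$, be formal power series that solve the system $$(u-vq^{b_{ij}})\,F_{ji}(z^{-1})=(q^{b_{ij}}u-v)\,F_{ij}(z),\qquad z=\frac uv,\qquad\text{for all } i,j \text{ with } a_{ij}\ne0. \tag{1}$$ Fix $i\ne j$ with $a_{ij}\neq 0$,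 put $n=1-a_{ij}$, and let $$P_{ij}(z_1,\dots,z_n,w)=\sum_{\pi\in\Sigma_n}\sum_{k=0}^{n}(-1)^k\begin{bmatrix} n\\k\end{bmatrix}_{q_i}\prod_{p<r}F_{ii}\Big(\frac{z_{\pi(r)}}{z_{\pi(p)}}\Big)\prod_{r=1}^kF_{ji}\Big(\frac{w}{z_{\pi(r)}}\Big)\prod_{s=k+1}^{n}F_{ij}\Big(\frac{z_{\pi(s)}}{w}\Big), \tag{2}$$ where $\begin{bmatrix} m\\k\end{bmatrix}_t=\frac{[m]_t!}{[k]_t!\,[m-k]_t!}$, $[m]_t!=[m]_t\cdots[1]_t$, $[m]_t=\frac{t^m-t^{-m}}{t-t^{-1}}$. Put $$s_{ij}=\prod_{p\ne r}\frac1{1-q^{b_{ii}}\frac{z_r}{z_p}},\qquad r_{ij}=\prod_{s=1}^{n}\frac1{1-q^{b_{ij}}\frac{z_s}{w}} .$$ Suppose that the product $$s_{ij}\cdot r_{ij}\cdot\Big(\prod_{p\neq r}\big(1-q^{b_{ii}}\tfrac{z_r}{z_p}\big)\Big)\cdot\Big(\prod_{s=1}^{n}\big(1-q^{b_{ij}}\tfrac{z_s}{w}\big)\Big)\cdot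 P_{ij}$$ is well defined, i.e. every product of series occurring in (2) exists, so that $P_{ij}$ is a formal power series, and the product of the five displayed series exists. Then $P_{ij}=0$ as a formal power series. -/

import Mathlib

noncomputable section

namespace QSerre

/-- Formal power series, infinite in all directions, with complex coefficients. `M` is the group
of exponents of monomials (`ℤ` for one variable); the value at `e` is the coefficient of `X^e`. -/
abbrev FPS (M : Type*) := M → ℂ

section Series

variable {M : Type*} [AddCommGroup M] {ι : Type*} [Fintype ι]

/-- The product of the finite family `f` exists: for every exponent `p` the series
`∑_{∑ e_i = p} ∏ f_i(e_i)` converges, independently of the ordering of its terms. -/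
def ProdExists (f : ι → FPS M) : Prop :=
  ∀ p : M, Summable (fun e : {e : ι → M // ∑ i, e i = p} => ∏ i, f i (e.1 i))

/-- The product of a finite family of formal power series (meaningful when it exists). -/
def prod (f : ι → FPS M) : FPS M :=
  fun p => ∑' e : {e : ι → M // ∑ i, e i = p}, ∏ i, f i (e.1 i)

/-- The product of two formal power series. -/
def mul (f g : FPS M) : FPS M := prod ![f, g]

/-- The monomial `X^m`. -/
def mon [DecidableEq M] (m : M) : FPS M := fun e => if e = m then 1 else 0

/-- The series `F(X^m) = ∑_n F_n X^(n m)`, for a one-variable series `F` and a monomial `X^m` of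
infinite order (so that `n ↦ n • m` is injective). -/
def at_ (F : FPS ℤ) (m : M) : FPS M := Function.extend (fun n : ℤ => n • m) F 0

/-- The geometric series `1 / (1 - c x) = ∑_{n ≥ 0} c^n x^n`. -/
def geom (c : ℂ) : FPS ℤ := fun n => if 0 ≤ n then c ^ n else 0

end Series

/-- Generalized Cartan matrices. -/
structure IsGenCartan {l : ℕ} (a : Matrix (Fin l) (Fin l) ℤ) : Prop where
  diag : ∀ i, a i i = 2
  nonpos : ∀ i j, i ≠ j → a i j ≤ 0
  zero_symm : ∀ i j, a i j = 0 → a j i = 0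

/-- `d` consists of (collectively) coprime positive integers that symmetrize `a`. -/
structure IsSymmetrizer {l : ℕ} (a : Matrix (Fin l) (Fin l) ℤ) (d : Fin l → ℕ) : Prop where
  pos : ∀ i, 0 < d i
  coprime : Finset.univ.gcd d = 1
  symm : ∀ i j, a i j * (d i : ℤ) = a j i * (d j : ℤ)

/-- `b_ij = a_ij d_i`. -/
def symmMatrix {l : ℕ} (a : Matrix (Fin l) (Fin l) ℤ) (d : Fin l → ℕ) (i j : Fin l) : ℤ :=
  a i j * (d i : ℤ)

/-- `[n]_t = (t^n - t^(-n)) / (t - t^(-1))`. -/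
def qInt (t : ℂ) (n : ℕ) : ℂ := (t ^ (n : ℤ) - t ^ (-(n : ℤ))) / (t - t⁻¹)

/-- `[n]_t! = [n]_t ⋯ [1]_t`. -/
def qFact (t : ℂ) (n : ℕ) : ℂ := ∏ k ∈ Finset.range n, qInt t (k + 1)

/-- The `t`-binomial coefficient `[m]_t! / ([k]_t! [m-k]_t!)`, for `k ≤ m`. -/
def qBinom (t : ℂ) (m k : ℕ) : ℂ := qFact t m / (qFact t k * qFact t (m - k))

/-- The functional system
`(u - v q^(b_ij)) F_ji(z⁻¹) = (q^(b_ij) u - v) F_ij(z)`, `z = u / v`, for all `i, j` with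
`a_ij ≠ 0`, as an identity of formal power series in `u = X^(1,0)` and `v = X^(0,1)`. -/
def IsSolution {l : ℕ} (a : Matrix (Fin l) (Fin l) ℤ) (d : Fin l → ℕ) (q : ℂ)
    (F : Fin l → Fin l → FPS ℤ) : Prop :=
  ∀ i j, a i j ≠ 0 →
    let u : ℤ × ℤ := (1, 0)
    let v : ℤ × ℤ := (0, 1)
    let c : ℂ := q ^ symmMatrix a d i j
    mul (mon u - c • mon v) (at_ (F j i) (v - u)) = mul (c • mon u - mon v) (at_ (F i j) (u - v))

/-- Exponents of monomials in `z_1, …, z_n, w`. -/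
abbrev Expo (n : ℕ) := (Fin n → ℤ) × ℤ

/-- The exponent of the variable `z_p`. -/
def zE {n : ℕ} (p : Fin n) : Expo n := (Pi.single p 1, 0)

/-- The exponent of the variable `w`. -/
def wE {n : ℕ} : Expo n := (0, 1)

section Serre

variable {l : ℕ} (a : Matrix (Fin l) (Fin l) ℤ) (d : Fin l → ℕ) (q : ℂ)
  (F : Fin l → Fin l → FPS ℤ) (i j : Fin l)

/-- The number `1 - a_ij` of variables `z`. -/
def nVars : ℕ := (1 - a i j).toNat

/-- The factors of the summand with index `(π, k)` of the `q`-Serre combination: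
`F_ii(z_π(q) / z_π(p))` for `p < q`, `F_ji(w / z_π(r))` for the first `k` indices `r`, and
`F_ij(z_π(s) / w)` for the remaining indices `s`. -/
def serreFactors (π : Equiv.Perm (Fin (nVars a i j))) (k : ℕ) :
    {x : Fin (nVars a i j) × Fin (nVars a i j) // x.1 < x.2} ⊕ Fin (nVars a i j) →
      FPS (Expo (nVars a i j))
  | Sum.inl x => at_ (F i i) (zE (π x.1.2) - zE (π x.1.1))
  | Sum.inr r =>
      if (r : ℕ) < k then at_ (F j i) (wE - zE (π r)) else at_ (F i j) (zE (π r) - wE)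

/-- `P_ij` is well defined: all the products of series in it exist. -/
def SerreExists : Prop :=
  ∀ (π : Equiv.Perm (Fin (nVars a i j))), ∀ k ∈ Finset.range (nVars a i j + 1),
    ProdExists (serreFactors a F i j π k)

/-- The `q`-Serre combination `P_ij(z_1, …, z_{1-a_ij}, w)`. -/
def serreP : FPS (Expo (nVars a i j)) :=
  ∑ π : Equiv.Perm (Fin (nVars a i j)), ∑ k ∈ Finset.range (nVars a i j + 1),
    ((-1) ^ k * qBinom (q ^ d i) (nVars a i j) k) • prod (serreFactors a F i j π k)

/-- `s_ij = ∏_{p ≠ q} 1 / (1 - q^(b_ii) z_q / z_p)`; for `0 < |q| < 1` this product of geometric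
series exists, since `b_ii > 0`. -/
def serreS : FPS (Expo (nVars a i j)) :=
  prod (fun x : {x : Fin (nVars a i j) × Fin (nVars a i j) // x.1 ≠ x.2} =>
    at_ (geom (q ^ symmMatrix a d i i)) (zE x.1.2 - zE x.1.1))

/-- `r_ij = ∏_s 1 / (1 - q^(b_ij) z_s / w)`, a product whose coefficients are finite sums. -/
def serreR : FPS (Expo (nVars a i j)) :=
  prod (fun s : Fin (nVars a i j) => at_ (geom (q ^ symmMatrix a d i j)) (zE s - wE))

/-- The Laurent polynomial `∏_{p ≠ q} (1 - q^(b_ii) z_q / z_p)`. -/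
def serreD : FPS (Expo (nVars a i j)) :=
  prod (fun x : {x : Fin (nVars a i j) × Fin (nVars a i j) // x.1 ≠ x.2} =>
    mon 0 - q ^ symmMatrix a d i i • mon (zE x.1.2 - zE x.1.1))

/-- The Laurent polynomial `∏_s (1 - q^(b_ij) z_s / w)`. -/
def serreE : FPS (Expo (nVars a i j)) :=
  prod (fun s : Fin (nVars a i j) => mon 0 - q ^ symmMatrix a d i j • mon (zE s - wE))

/-- The product `s_ij · r_ij · ∏_{p ≠ q} (1 - q^(b_ii) z_q / z_p) · ∏_s (1 - q^(b_ij) z_s / w) · P_ij`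
is well defined: `P_ij` is well defined, and the product of these five series exists. -/
def ConstraintProductExists : Prop :=
  SerreExists a F i j ∧
    ProdExists ![serreS a d q i j, serreR a d q i j, serreD a d q i j, serreE a d q i j,
      serreP a d q F i j]

end Serre

end QSerre

end

/-! Write c = q^(b_ii), e = q^(b_ij), t = q_i, so that c = t² and e = t^(-N) with N = -a_ij. The
Laurent polynomial D = ∏_{p≠r} (1 - c z_r/z_p) kills P_ij, and the existence hypothesis allows D to
be cancelled.

D kills P_ij. The series (1 - c z_r/z_p) F_ii(z_r/z_p) is, by the system, antisymmetric in p, r up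
to a monomial (`edge_swap`). Since e² ≠ 1, both F_ji(w/z_s) and F_ij(z_s/w) are explicit Laurent
polynomials times one series, `spoke`. Hence D times each summand is a Laurent polynomial times a
single product of series, the same for all (π, k) (`act_discr_prod_factors`). What remains is the
vanishing of a Laurent polynomial, the antisymmetrization of ∏_{p<r} (z_r - c z_p) times linear
factors (`serre_identity`). The antisymmetrization of ∏_{p<r} (z_r - c z_p) ∏_{r∈I} z_r depends on I
only through |I|, up to a power of c. So the sum factors linearly through the specialization z_r =
c^(-r) Y, where the q-binomial theorem applies.

Cancelling D. Alone, D P = 0 does not give P = 0, because formal series in all directions have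
torsion: (1 - x) ∑ x^n = 0. Existence of the five-fold product makes a multiple series summable, and
it may be summed in two ways: one produces D P = 0 as a factor, the other cancels s_ij and r_ij
against their inverses and leaves P (`eq_zero_of_prodExists`). -/

noncomputable section

namespace QSerre

open Finset Function

/-! ### Products of formal series and the module structure over Laurent polynomials. -/

section Multiplication

variable {M : Type*} [AddCommGroup M] {ι κ : Type*} [Fintype ι] [Fintype κ]

/-- The product of the family `f` exists and is equal to `g`. -/
def HasProduct (f : ι → FPS M) (g : FPS M) : Prop :=
  ∀ p : M, HasSum (fun e : {e : ι → M // ∑ i, e i = p} => ∏ i, f i (e.1 i)) (g p)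

lemma ProdExists.hasProduct {f : ι → FPS M} (h : ProdExists f) : HasProduct f (prod f) :=
  fun p => (h p).hasSum

lemma HasProduct.prodExists {f : ι → FPS M} {g : FPS M} (h : HasProduct f g) : ProdExists f :=
  fun p => (h p).summable

lemma HasProduct.unique {f : ι → FPS M} {g g' : FPS M} (h : HasProduct f g)
    (h' : HasProduct f g') : g = g' :=
  funext fun p => (h p).unique (h' p)

lemma HasProduct.prod_eq {f : ι → FPS M} {g : FPS M} (h : HasProduct f g) : prod f = g :=
  h.prodExists.hasProduct.unique h

lemma HasProduct.reindex {f : κ → FPS M} {g : FPS M} (σ : ι ≃ κ)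
    (h : HasProduct (fun i => f (σ i)) g) : HasProduct f g := by
  intro p
  let E : {e : κ → M // ∑ i, e i = p} ≃ {e : ι → M // ∑ i, e i = p} :=
    (Equiv.arrowCongr σ.symm (Equiv.refl M)).subtypeEquiv fun e => by
      simp [Equiv.arrowCongr, Equiv.sum_comp σ e]
  convert E.hasSum_iff.2 (h p) using 2 with e
  exact (Equiv.prod_comp σ fun k => f k (e.1 k)).symm

/-- The operation of multiplying with the monomial `X^m`. -/
def shift : Multiplicative M →* Module.End ℂ (FPS M) where
  toFun m :=
    { toFun := fun f e => f (e - m.toAdd)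
      map_add' := fun _ _ => rfl
      map_smul' := fun _ _ => rfl }
  map_one' := by ext; simp
  map_mul' m m' := by
    ext f e
    simp only [LinearMap.coe_mk, AddHom.coe_mk, toAdd_mul, Module.End.mul_apply]
    congr 1
    abel

/-- The action of Laurent polynomials on formal power series. -/
def act : AddMonoidAlgebra ℂ M →ₐ[ℂ] Module.End ℂ (FPS M) :=
  AddMonoidAlgebra.lift ℂ _ M shift

/-- The monomial `X^m` as a Laurent polynomial. -/
def X (m : M) : AddMonoidAlgebra ℂ M := AddMonoidAlgebra.single m 1

lemma X_add (m m' : M) : X (m + m') = X m * X m' := by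
  simp [X, AddMonoidAlgebra.single_mul_single]

lemma X_zero : X (0 : M) = 1 := rfl

lemma act_X (m : M) (f : FPS M) (p : M) : act (X m) f p = f (p - m) := by
  simp [act, X, shift]

lemma act_mul (L K : AddMonoidAlgebra ℂ M) (f : FPS M) : act (L * K) f = act L (act K f) := by
  simp

/-- Writes the finite convolution as a sum over all exponents, the form in which it appears as an
inner sum of a multiple series. -/
lemma act_hasSum (L : AddMonoidAlgebra ℂ M) (f : FPS M) (p : M) :
    HasSum (fun m => L.coeff m * f (p - m)) (act L f p) := by
  have : act L f p = ∑ m ∈ L.coeff.support, L.coeff m * f (p - m) := by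
    simp [act, AddMonoidAlgebra.lift_apply, Finsupp.sum, shift]
  rw [this]
  refine hasSum_sum_of_ne_finset_zero fun m hm => ?_
  simp [Finsupp.notMem_support_iff.1 hm]

lemma act_mon_zero [DecidableEq M] (L : AddMonoidAlgebra ℂ M) : act L (mon 0) = L.coeff := by
  ext p
  refine (act_hasSum L (mon 0) p).unique ?_
  convert hasSum_single p ?_ using 1
  · simp [mon]
  · intro m hm
    simp [mon, sub_eq_zero, hm.symm]

lemma act_X_mon_zero [DecidableEq M] (m : M) : act (X m) (mon 0) = mon m := by
  ext p
  simp [act_X, mon, sub_eq_zero]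

lemma prod_update_apply {M ι : Type*} [Fintype ι] [DecidableEq ι] (f : ι → FPS M) (i : ι) (a : FPS M)
    (e : ι → M) :
    ∏ j, update f i a j (e j) = a (e i) * ∏ j ∈ univ \ {i}, f j (e j) := by
  have : ∀ j, update f i a j (e j) = update (fun j => f j (e j)) i (a (e i)) j := by
    intro j
    rcases eq_or_ne j i with rfl | h <;> simp [*]
  simp_rw [this]
  exact prod_update_of_mem (mem_univ i) _ _

section Factors

variable [DecidableEq ι]

lemma HasProduct.update_add {f : ι → FPS M} {i : ι} {a b g h : FPS M}
    (ha : HasProduct (update f i a) g) (hb : HasProduct (update f i b) h) :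
    HasProduct (update f i (a + b)) (g + h) := by
  intro p
  convert! (ha p).add (hb p) using 2 with e
  simp [prod_update_apply, add_mul]

lemma HasProduct.update_smul {f : ι → FPS M} {i : ι} {a g : FPS M} (c : ℂ)
    (ha : HasProduct (update f i a) g) : HasProduct (update f i (c • a)) (c • g) := by
  intro p
  convert! (ha p).mul_left c using 2 with e
  simp [prod_update_apply, mul_assoc]

lemma HasProduct.update_zero (f : ι → FPS M) (i : ι) : HasProduct (update f i 0) 0 := by
  intro p
  simp [prod_update_apply]

/-- Translating the i-th exponent by m is a bijection between the index sets for p and p - m that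
matches the terms. -/
lemma HasProduct.update_X {f : ι → FPS M} {i : ι} {a g : FPS M} (m : M)
    (ha : HasProduct (update f i a) g) :
    HasProduct (update f i (act (X m) a)) (act (X m) g) := by
  intro p
  rw [act_X]
  let E : {e : ι → M // ∑ i, e i = p} ≃ {e : ι → M // ∑ i, e i = p - m} :=
    (Equiv.subRight (Pi.single i m)).subtypeEquiv fun e => by
      simp [sum_sub_distrib]
  convert E.hasSum_iff.2 (ha (p - m)) using 2 with e
  simp only [prod_update_apply, act_X, E, comp_apply, Equiv.subtypeEquiv_apply,
    Equiv.subRight_apply, Pi.sub_apply, Pi.single_eq_same]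
  congr 1
  refine prod_congr rfl fun j hj => ?_
  have : j ≠ i := by simpa using hj
  simp [this]

lemma HasProduct.update_act {f : ι → FPS M} {i : ι} {a g : FPS M} (L : AddMonoidAlgebra ℂ M)
    (ha : HasProduct (update f i a) g) :
    HasProduct (update f i (act L a)) (act L g) := by
  induction L using AddMonoidAlgebra.induction_linear with
  | zero => simpa using HasProduct.update_zero f i
  | add L K hL hK => simpa using hL.update_add hK
  | single m c =>
    have : (AddMonoidAlgebra.single m c : AddMonoidAlgebra ℂ M) = c • X m := by simp [X]
    rw [this]
    simpa using (ha.update_X m).update_smul c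

/-- Laurent polynomials multiplied with the factors may be collected in front of the product. -/
lemma HasProduct.act {f : ι → FPS M} {g : FPS M} (h : HasProduct f g)
    (L : ι → AddMonoidAlgebra ℂ M) :
    HasProduct (fun i => act (L i) (f i)) (act (∏ i, L i) g) := by
  have key : ∀ s : Finset ι, HasProduct (fun i => if i ∈ s then QSerre.act (L i) (f i) else f i)
      (QSerre.act (∏ i ∈ s, L i) g) := by
    intro s
    induction s using Finset.induction_on with
    | empty => simpa using h
    | insert i s hi ih =>
      rw [prod_insert hi, act_mul]
      have h1 : update (fun j => if j ∈ s then QSerre.act (L j) (f j) else f j) i (f i) =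
          fun j => if j ∈ s then QSerre.act (L j) (f j) else f j := by
        simp [hi]
      rw [← h1] at ih
      convert ih.update_act (L i) using 1
      ext j p
      rcases eq_or_ne j i with rfl | hj <;> simp [*]
  simpa using key univ

/-- If all products with factors chosen from `f i`, `g i` exist, then so does the product of
linear combinations. -/
lemma ProdExists.smul_add_smul {f g : ι → FPS M}
    (h : ∀ s : Finset ι, ProdExists fun i => if i ∈ s then f i else g i) (α β : ι → ℂ) :
    ProdExists fun i => α i • f i + β i • g i := by
  -- Multilinearity, one factor at a time: positions in `t` already carry the combination, the
  -- others still an arbitrary choice `s`.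
  have key : ∀ t s : Finset ι, ProdExists fun i =>
      if i ∈ t then α i • f i + β i • g i else if i ∈ s then f i else g i := by
    intro t
    induction t using Finset.induction_on with
    | empty => simpa using h
    | insert i t hi ih =>
      intro s
      have e : ∀ s' : Finset ι, (∀ j ≠ i, j ∈ s' ↔ j ∈ s) → ProdExists
          (update (fun j => if j ∈ t then α j • f j + β j • g j else if j ∈ s then f j else g j) i
            (if i ∈ s' then f i else g i)) := by
        intro s' hs'
        convert ih s' using 1
        ext j p
        rcases eq_or_ne j i with rfl | hj <;> simp [*]
      have h1 := e (insert i s) (by simp +contextual)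
      have h2 := e (s.erase i) (by simp +contextual)
      simp only [mem_insert_self, notMem_erase, if_true, if_false] at h1 h2
      convert ((h1.hasProduct.update_smul (α i)).update_add
        (h2.hasProduct.update_smul (β i))).prodExists using 1
      ext j p
      rcases eq_or_ne j i with rfl | hj <;> simp [*]
  simpa using key univ ∅

end Factors

lemma hasProduct_mon_zero [DecidableEq M] :
    HasProduct (fun _ : ι => (mon 0 : FPS M)) (mon 0) := by
  intro p
  by_cases hp : p = 0
  · subst hp
    convert hasSum_single (⟨0, by simp⟩ : {e : ι → M // ∑ i, e i = 0}) ?_ using 1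
    · simp [mon]
    · rintro ⟨e, he⟩ hne
      have : ∃ i, e i ≠ 0 := by
        by_contra! h
        exact hne (Subtype.ext (funext h))
      obtain ⟨i, hi⟩ := this
      exact prod_eq_zero (mem_univ i) (by simp [mon, hi])
  · convert hasSum_zero using 2 with e
    · have : ∃ i, e.1 i ≠ 0 := by
        by_contra! h
        exact hp (by rw [← e.2]; simp [h])
      obtain ⟨i, hi⟩ := this
      exact prod_eq_zero (mem_univ i) (by simp [mon, hi])
    · simp [mon, hp]

lemma prod_act_mon_zero [DecidableEq M] (L : ι → AddMonoidAlgebra ℂ M) :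
    prod (fun i => act (L i) (mon 0)) = act (∏ i, L i) (mon 0) := by
  classical
  exact (hasProduct_mon_zero.act L).prod_eq

lemma hasProduct_mon_zero_pair [DecidableEq M] (g : FPS M) :
    HasProduct ![mon 0, g] g := by
  intro p
  convert hasSum_single (⟨![0, p], by simp⟩ : {e : Fin 2 → M // ∑ i, e i = p}) ?_ using 1
  · simp [mon]
  · rintro ⟨e, he⟩ hne
    have : e 0 ≠ 0 := by
      intro h
      apply hne
      ext i
      fin_cases i
      · exact h
      · simpa [h] using he
    simp [mon, this]

lemma mul_act_mon_zero [DecidableEq M] (L : AddMonoidAlgebra ℂ M) (g : FPS M) :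
    mul (act L (mon 0)) g = act L g := by
  have h := (hasProduct_mon_zero_pair g).act ![L, 1]
  refine HasProduct.prod_eq ?_
  convert h using 1
  · ext i
    fin_cases i <;> simp
  · simp

end Multiplication

/-! ### Gaussian binomial coefficients. -/

section Binomial

variable {t : ℂ}

lemma zpow_ne_one_of_norm_lt_one (ht1 : ‖t‖ < 1) {k : ℤ} (hk : k ≠ 0) :
    t ^ k ≠ 1 := by
  intro h
  have h1 : ‖t‖ ^ k = 1 := by rw [← norm_zpow, h, norm_one]
  exact hk ((zpow_eq_one_iff_right₀ (norm_nonneg t) ht1.ne).1 h1)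

lemma qInt_succ_ne_zero (ht0 : t ≠ 0) (ht1 : ‖t‖ < 1) (k : ℕ) : qInt t (k + 1) ≠ 0 := by
  have key : ∀ m : ℕ, t ^ ((m + 1 : ℕ) : ℤ) - t ^ (-((m + 1 : ℕ) : ℤ)) ≠ 0 := by
    intro m h
    have h1 : t ^ (2 * ((m + 1 : ℕ) : ℤ)) = 1 := by
      rw [two_mul, zpow_add₀ ht0]
      nth_rw 1 [sub_eq_zero.1 h]
      rw [← zpow_add₀ ht0]
      simp
    exact zpow_ne_one_of_norm_lt_one ht1 (by positivity) h1
  refine div_ne_zero (key k) ?_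
  simpa using key 0

lemma qFact_ne_zero (ht0 : t ≠ 0) (ht1 : ‖t‖ < 1) (k : ℕ) : qFact t k ≠ 0 :=
  prod_ne_zero_iff.2 fun m _ => qInt_succ_ne_zero ht0 ht1 m

lemma qFact_succ (t : ℂ) (k : ℕ) : qFact t (k + 1) = qFact t k * qInt t (k + 1) :=
  prod_range_succ _ _

lemma qInt_add (ht0 : t ≠ 0) (k m : ℕ) :
    qInt t (k + m) = t ^ k * qInt t m + (t ^ m)⁻¹ * qInt t k := by
  simp only [qInt, zpow_natCast, zpow_neg, pow_add, mul_inv]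
  rw [← mul_div_assoc, ← mul_div_assoc, ← add_div]
  congr 1
  field_simp
  ring

lemma qBinom_zero (ht0 : t ≠ 0) (ht1 : ‖t‖ < 1) (n : ℕ) : qBinom t n 0 = 1 := by
  simp [qBinom, qFact_ne_zero ht0 ht1, show qFact t 0 = 1 by simp [qFact]]

lemma qBinom_self (ht0 : t ≠ 0) (ht1 : ‖t‖ < 1) (n : ℕ) : qBinom t n n = 1 := by
  simp [qBinom, qFact_ne_zero ht0 ht1, show qFact t 0 = 1 by simp [qFact]]

lemma qBinom_pascal (ht0 : t ≠ 0) (ht1 : ‖t‖ < 1) (k m : ℕ) :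
    qBinom t (k + 1 + m + 1) (k + 1) =
      t ^ (k + 1) * qBinom t (k + 1 + m) (k + 1) + (t ^ (m + 1))⁻¹ * qBinom t (k + 1 + m) k := by
  have h1 : k + 1 + m + 1 - (k + 1) = m + 1 := by omega
  have h2 : k + 1 + m - (k + 1) = m := by omega
  have h3 : k + 1 + m - k = m + 1 := by omega
  simp only [qBinom, h1, h2, h3, qFact_succ t (k + 1 + m), qFact_succ t k, qFact_succ t m]
  rw [show k + 1 + m + 1 = (k + 1) + (m + 1) by ring, qInt_add ht0 (k + 1) (m + 1)]
  have := qFact_ne_zero ht0 ht1 k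
  have := qFact_ne_zero ht0 ht1 m
  have := qInt_succ_ne_zero ht0 ht1 k
  have := qInt_succ_ne_zero ht0 ht1 m
  field_simp

/-- A step of the `q`-binomial theorem. -/
lemma sum_qBinom_succ (ht0 : t ≠ 0) (ht1 : ‖t‖ < 1) (n : ℕ) (x : ℂ) :
    ∑ k ∈ range (n + 2), (-1) ^ k * qBinom t (n + 1) k * x ^ k =
      (1 - x * (t ^ n)⁻¹) * ∑ k ∈ range (n + 1), (-1) ^ k * qBinom t n k * (t * x) ^ k := by
  have h1 : ∀ k ∈ range n, (-1) ^ (k + 1) * qBinom t (n + 1) (k + 1) * x ^ (k + 1) =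
      (-1) ^ (k + 1) * qBinom t n (k + 1) * (t * x) ^ (k + 1) -
        x * (t ^ n)⁻¹ * ((-1) ^ k * qBinom t n k * (t * x) ^ k) := by
    intro k hk
    obtain ⟨m, rfl⟩ := Nat.exists_eq_add_of_lt (mem_range.1 hk)
    rw [show k + m + 1 = k + 1 + m by ring, qBinom_pascal ht0 ht1]
    simp only [mul_pow, pow_add]
    field_simp
    ring
  have h2 := sum_range_succ' (fun k => (-1) ^ k * qBinom t n k * (t * x) ^ k) n
  have h3 := sum_range_succ (fun k => (-1) ^ k * qBinom t n k * (t * x) ^ k) n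
  have h4 : x * (t ^ n)⁻¹ * (t * x) ^ n = x ^ (n + 1) := by
    rw [mul_pow, pow_succ]
    field_simp
  rw [sum_range_succ, sum_range_succ', sum_congr rfl h1, sum_sub_distrib, sub_mul, one_mul,
    ← mul_sum, qBinom_self ht0 ht1, qBinom_zero ht0 ht1]
  simp only [qBinom_self ht0 ht1, qBinom_zero ht0 ht1] at h2 h3
  linear_combination -h2 + x * (t ^ n)⁻¹ * h3 + (-1) ^ n * h4

/-- The points t^(n-2m), 0 ≤ m ≤ n, are the roots of the q-binomial polynomial. In the recursion, m
= 0 kills the split-off factor, and x ↦ t x sends (n+1, m+1) to (n, m). -/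
lemma sum_qBinom_eq_zero (ht0 : t ≠ 0) (ht1 : ‖t‖ < 1) (n : ℕ) :
    ∀ m ≤ n, ∑ k ∈ range (n + 2), (-1) ^ k * qBinom t (n + 1) k * (t ^ n * (t ^ (2 * m))⁻¹) ^ k
      = 0 := by
  induction n with
  | zero =>
    intro m hm
    obtain rfl : m = 0 := by omega
    rw [sum_qBinom_succ ht0 ht1]
    simp
  | succ n ih =>
    intro m hm
    rw [sum_qBinom_succ ht0 ht1]
    rcases m with _ | m
    · simp [ht0]
    · rw [show t * (t ^ (n + 1) * (t ^ (2 * (m + 1)))⁻¹) = t ^ n * (t ^ (2 * m))⁻¹ by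
        field_simp
        ring, ih m (by omega), mul_zero]

end Binomial

/-! ### The specialized Serre identity. -/

section Scalar

open Polynomial

/-- The `q`-Serre identity after the specialization `z_r = t^(-2 r) y`, `w = 1`. -/
lemma sum_qBinom_prod_eq_zero {t : ℂ} (ht0 : t ≠ 0) (ht1 : ‖t‖ < 1) (N : ℕ) (y : ℂ) :
    ∑ k ∈ range (N + 2), (-1) ^ k * qBinom t (N + 1) k *
      ∏ r ∈ range (N + 1), (if r < k then (t ^ N)⁻¹ * (t ^ (2 * r))⁻¹ * y - 1
        else (t ^ (2 * r))⁻¹ * y - (t ^ N)⁻¹) = 0 := by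
  set g : ℕ → ℂ := fun r => t ^ N * (t ^ (2 * r))⁻¹ * y - 1 with hg
  set W : ℂ[X] := ∏ r ∈ range N, (C (t ^ N * (t ^ (2 * r))⁻¹) * Polynomial.X - 1) with hW
  have hWdeg : W.natDegree < N + 1 := by
    refine Nat.lt_succ_of_le ((natDegree_prod_le _ _).trans ?_)
    refine (sum_le_card_nsmul _ _ 1 fun r _ => ?_).trans (by simp)
    compute_degree
  -- Up to powers of t, the factors with r < k are g(N), …, g(N+k-1) and the others g(k), …, g(N).
  -- Apart from the repeated g(N) they fill a window of N consecutive values, which is W at t^(-2k)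
  -- y.
  have hwin : ∀ k ∈ range (N + 2),
      ∏ r ∈ range (N + 1), (if r < k then (t ^ N)⁻¹ * (t ^ (2 * r))⁻¹ * y - 1
        else (t ^ (2 * r))⁻¹ * y - (t ^ N)⁻¹) =
      ((t ^ N)⁻¹) ^ (N + 1) * g N * ((t ^ N) ^ k * W.eval ((t ^ (2 * k))⁻¹ * y)) := by
    intro k hk
    have hk' : k ≤ N + 1 := by simpa [Nat.lt_succ_iff] using hk
    have e1 : ∀ r ∈ range k, (if r < k then (t ^ N)⁻¹ * (t ^ (2 * r))⁻¹ * y - 1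
        else (t ^ (2 * r))⁻¹ * y - (t ^ N)⁻¹) = g (N + r) := by
      intro r hr
      rw [if_pos (mem_range.1 hr), hg]
      simp only [mul_add, pow_add, two_mul]
      field_simp
    have e2 : ∀ r ∈ Ico k (N + 1), (if r < k then (t ^ N)⁻¹ * (t ^ (2 * r))⁻¹ * y - 1
        else (t ^ (2 * r))⁻¹ * y - (t ^ N)⁻¹) = (t ^ N)⁻¹ * g r := by
      intro r hr
      rw [if_neg (not_lt.2 (mem_Ico.1 hr).1), hg]
      field_simp
    have e3 : W.eval ((t ^ (2 * k))⁻¹ * y) = ∏ r ∈ Ico k (N + k), g r := by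
      rw [hW, eval_prod, prod_Ico_eq_prod_range, Nat.add_sub_cancel]
      refine prod_congr rfl fun r _ => ?_
      simp only [hg, eval_sub, eval_mul, eval_C, eval_X, eval_one, mul_add, pow_add]
      field_simp
    have e4 : (∏ r ∈ range k, g (N + r)) = ∏ r ∈ Ico N (N + k), g r := by
      rw [prod_Ico_eq_prod_range, Nat.add_sub_cancel_left]
    have e5 : (∏ r ∈ Ico N (N + k), g r) * ∏ r ∈ Ico k (N + 1), g r =
        g N * ∏ r ∈ Ico k (N + k), g r := by
      rcases Nat.lt_or_ge k (N + 1) with h | h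
      · rw [prod_Ico_succ_top (by omega), ← prod_Ico_consecutive g (show k ≤ N by omega)
          (show N ≤ N + k by omega)]
        ring
      · obtain rfl : k = N + 1 := by omega
        rw [prod_eq_prod_Ico_succ_bot (by omega)]
        simp
    have e6 : ((t ^ N)⁻¹) ^ (N + 1) * (t ^ N) ^ k = ((t ^ N)⁻¹) ^ (N + 1 - k) := by
      have : ((t ^ N)⁻¹) ^ (N + 1) = ((t ^ N)⁻¹) ^ (N + 1 - k) * ((t ^ N)⁻¹) ^ k := by
        rw [← pow_add, Nat.sub_add_cancel hk']
      rw [this, mul_assoc, ← mul_pow, inv_mul_cancel₀ (pow_ne_zero _ ht0), one_pow, mul_one]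
    rw [← prod_range_mul_prod_Ico _ hk', prod_congr rfl e1, prod_congr rfl e2, prod_mul_distrib,
      prod_const, Nat.card_Ico, e3, e4, ← e6]
    linear_combination ((t ^ N)⁻¹) ^ (N + 1) * (t ^ N) ^ k * e5
  -- W has degree at most N, so each of its monomials contributes t^((N-2m)k) with m ≤ N, and the
  -- alternating sum vanishes.
  have hcol : ∀ m ∈ range (N + 1), ∑ k ∈ range (N + 2), (-1) ^ k * qBinom t (N + 1) k *
      ((t ^ N) ^ k * (W.coeff m * ((t ^ (2 * k))⁻¹ * y) ^ m)) = 0 := by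
    intro m hm
    have h := sum_qBinom_eq_zero ht0 ht1 N m (Nat.lt_succ_iff.1 (mem_range.1 hm))
    rw [← mul_zero (W.coeff m * y ^ m), ← h, mul_sum]
    refine sum_congr rfl fun k _ => ?_
    simp only [mul_pow, inv_pow, ← pow_mul]
    rw [show 2 * k * m = 2 * m * k by ring]
    ring
  calc _ = ∑ k ∈ range (N + 2), ((t ^ N)⁻¹) ^ (N + 1) * g N * ∑ m ∈ range (N + 1),
        (-1) ^ k * qBinom t (N + 1) k *
          ((t ^ N) ^ k * (W.coeff m * ((t ^ (2 * k))⁻¹ * y) ^ m)) := by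
        refine sum_congr rfl fun k hk => ?_
        rw [hwin k hk, eval_eq_sum_range' hWdeg, ← mul_sum, ← mul_sum]
        ring
    _ = 0 := by rw [← mul_sum, sum_comm, sum_eq_zero hcol, mul_zero]

end Scalar

/-! ### Antisymmetrization and the Serre identity for polynomials. -/

section Antisymmetrization

variable {R : Type*} [CommRing R]

/-- An adjacent transposition permutes the increasing pairs, except that it reverses (i, i+1). -/
lemma prod_pairs_swap {n : ℕ} (i : Fin n) (h : Fin (n + 1) → Fin (n + 1) → R) :
    (∏ x : {x : Fin (n + 1) × Fin (n + 1) // x.1 < x.2},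
        h (Equiv.swap i.castSucc i.succ x.1.1) (Equiv.swap i.castSucc i.succ x.1.2)) *
      h i.castSucc i.succ =
    (∏ x : {x : Fin (n + 1) × Fin (n + 1) // x.1 < x.2}, h x.1.1 x.1.2) *
      h i.succ i.castSucc := by
  set s := Equiv.swap i.castSucc i.succ with hs
  let x₀ : {x : Fin (n + 1) × Fin (n + 1) // x.1 < x.2} :=
    ⟨(i.castSucc, i.succ), Fin.castSucc_lt_succ⟩
  have hmem : ∀ x : Fin (n + 1) × Fin (n + 1), x.1 < x.2 → x ≠ (i.castSucc, i.succ) →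
      s x.1 < s x.2 ∧ (s x.1, s x.2) ≠ (i.castSucc, i.succ) := by
    rintro ⟨x, y⟩ hlt hne
    simp only [hs, Equiv.swap_apply_def, ne_eq, Prod.mk.injEq, Fin.ext_iff, Fin.lt_def] at *
    simp only [Fin.val_castSucc, Fin.val_succ] at *
    split_ifs <;> simp_all <;> omega
  have key : ∏ x ∈ univ.erase x₀, h (s x.1.1) (s x.1.2) =
      ∏ x ∈ univ.erase x₀, h x.1.1 x.1.2 := by
    have hx : ∀ x ∈ univ.erase x₀, x.1 ≠ (i.castSucc, i.succ) := by
      intro x hx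
      simpa [x₀, Subtype.ext_iff] using hx
    refine prod_bij'
      (fun x hx' => ⟨(s x.1.1, s x.1.2), (hmem x.1 x.2 (hx x hx')).1⟩)
      (fun x hx' => ⟨(s x.1.1, s x.1.2), (hmem x.1 x.2 (hx x hx')).1⟩) ?_ ?_ ?_ ?_ ?_
    · intro x hx'
      simpa [x₀, Subtype.ext_iff] using (hmem x.1 x.2 (hx x hx')).2
    · intro x hx'
      simpa [x₀, Subtype.ext_iff] using (hmem x.1 x.2 (hx x hx')).2
    · intro x _
      simp [hs]
    · intro x _
      simp [hs]
    · intro x _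
      rfl
  rw [← mul_prod_erase univ _ (mem_univ x₀), ← mul_prod_erase univ _ (mem_univ x₀), key]
  simp only [x₀, hs, Equiv.swap_apply_left, Equiv.swap_apply_right]
  ring

/-- `∏_{p < r} (z_r - τ z_p)`. -/
def pairProd {n : ℕ} (τ : R) (z : Fin n → R) : R :=
  ∏ x : {x : Fin n × Fin n // x.1 < x.2}, (z x.1.2 - τ * z x.1.1)

/-- The antisymmetrization of `∏_{p < r} (z_r - τ z_p) ∏_{r ∈ I} z_r`. -/
def antisymm {n : ℕ} (τ : R) (z : Fin n → R) (I : Finset (Fin n)) : R :=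
  ∑ π : Equiv.Perm (Fin n), (Equiv.Perm.sign π : ℤ) •
    (pairProd τ (z ∘ π) * ∏ r ∈ I, z (π r))

lemma pairProd_swap {n : ℕ} (τ : R) (z : Fin (n + 1) → R) (i : Fin n) :
    pairProd τ (z ∘ Equiv.swap i.castSucc i.succ) * (z i.succ - τ * z i.castSucc) =
      pairProd τ z * (z i.castSucc - τ * z i.succ) :=
  prod_pairs_swap i fun p r => z r - τ * z p

/-- In the difference of the two sides each term contains z_i - τ z_(i+1), the factor by which
`pairProd` changes under the adjacent transposition; the terms of π and π s therefore cancel. -/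
lemma antisymm_move {n : ℕ} (τ : R) (z : Fin (n + 1) → R) (i : Fin n)
    (I : Finset (Fin (n + 1))) (h0 : i.castSucc ∉ I) (h1 : i.succ ∉ I) :
    antisymm τ z (insert i.castSucc I) = τ * antisymm τ z (insert i.succ I) := by
  set s := Equiv.swap i.castSucc i.succ with hs
  rw [← sub_eq_zero, antisymm, antisymm, mul_sum, ← sum_sub_distrib]
  refine sum_involution (fun π _ => π * s) ?_ ?_ (by simp) ?_
  · intro π _
    have hI : ∏ r ∈ I, z ((π * s) r) = ∏ r ∈ I, z (π r) := by
      refine prod_congr rfl fun r hr => ?_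
      rw [Equiv.Perm.mul_apply, hs, Equiv.swap_apply_of_ne_of_ne]
      · rintro rfl; exact h0 hr
      · rintro rfl; exact h1 hr
    have hp := pairProd_swap τ (z ∘ π) i
    have hc : (z ∘ π) ∘ Equiv.swap i.castSucc i.succ = z ∘ (π * s) := rfl
    rw [hc] at hp
    have hsign : Equiv.Perm.sign (π * s) = -Equiv.Perm.sign π := by
      rw [Equiv.Perm.sign_mul, hs, Equiv.Perm.sign_swap (Fin.castSucc_lt_succ).ne]
      simp
    rw [prod_insert h0, prod_insert h1, prod_insert h0, prod_insert h1, hI, hsign]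
    simp only [Equiv.Perm.mul_apply, hs, Equiv.swap_apply_left, Equiv.swap_apply_right,
      zsmul_eq_mul, Units.val_neg, Int.cast_neg, comp_apply] at hp ⊢
    linear_combination (-((Equiv.Perm.sign π : ℤ) : R) * ∏ r ∈ I, z (π r)) * hp
  · intro π _ _ h
    have : s = 1 := by simpa using h
    exact (Fin.castSucc_lt_succ (i := i)).ne (by simpa [hs, Equiv.swap_eq_one_iff] using this)
  · intro π _
    simp [mul_assoc, hs]

/-- The transposition moves I only if I contains exactly one of i, i+1; then the index sum changes
by one and absorbs the τ of `antisymm_move`. -/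
lemma antisymm_swap {n : ℕ} (τ : R) (z : Fin (n + 1) → R) (i : Fin n)
    (I : Finset (Fin (n + 1))) :
    τ ^ (∑ r ∈ I.map (Equiv.swap i.castSucc i.succ).toEmbedding, (r : ℕ)) *
        antisymm τ z (I.map (Equiv.swap i.castSucc i.succ).toEmbedding) =
      τ ^ (∑ r ∈ I, (r : ℕ)) * antisymm τ z I := by
  set s := Equiv.swap i.castSucc i.succ with hs
  have hne : i.castSucc ≠ i.succ := (Fin.castSucc_lt_succ).ne
  have hfix : ∀ J : Finset (Fin (n + 1)), i.castSucc ∉ J → i.succ ∉ J →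
      J.map s.toEmbedding = J := by
    intro J h0 h1
    ext r
    simp only [mem_map_equiv, hs, Equiv.symm_swap, Equiv.swap_apply_def]
    split_ifs with h h' <;> simp_all
  set J := (I.erase i.castSucc).erase i.succ with hJ
  have h0 : i.castSucc ∉ J := by simp [hJ]
  have h1 : i.succ ∉ J := by simp [hJ]
  have hJs := hfix J h0 h1
  have hmove := antisymm_move τ z i J h0 h1
  have hs0 : s i.castSucc = i.succ := by simp [hs]
  have hs1 : s i.succ = i.castSucc := by simp [hs]
  by_cases c0 : i.castSucc ∈ I <;> by_cases c1 : i.succ ∈ I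
  · have hI : I = insert i.castSucc (insert i.succ J) := by
      ext r; simp only [hJ, mem_insert, mem_erase]; grind
    have : I.map s.toEmbedding = I := by
      rw [hI, map_insert, map_insert, hJs]
      simp only [Equiv.coe_toEmbedding, hs0, hs1]
      exact insert_comm _ _ _
    rw [this]
  · have hI : I = insert i.castSucc J := by
      ext r; simp only [hJ, mem_insert, mem_erase]; grind
    rw [hI, map_insert, hJs]
    simp only [Equiv.coe_toEmbedding, hs0]
    rw [sum_insert h0, sum_insert h1, hmove]
    simp only [Fin.val_castSucc, Fin.val_succ]
    ring
  · have hI : I = insert i.succ J := by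
      ext r; simp only [hJ, mem_insert, mem_erase]; grind
    rw [hI, map_insert, hJs]
    simp only [Equiv.coe_toEmbedding, hs1]
    rw [sum_insert h0, sum_insert h1, hmove]
    simp only [Fin.val_castSucc, Fin.val_succ]
    ring
  · rw [hfix I c0 c1]

lemma antisymm_map {n : ℕ} (τ : R) (z : Fin (n + 1) → R) (σ : Equiv.Perm (Fin (n + 1))) :
    ∀ I : Finset (Fin (n + 1)),
    τ ^ (∑ r ∈ I.map σ.toEmbedding, (r : ℕ)) * antisymm τ z (I.map σ.toEmbedding) =
      τ ^ (∑ r ∈ I, (r : ℕ)) * antisymm τ z I := by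
  have hσ : σ ∈ Submonoid.closure (Set.range fun i : Fin n => Equiv.swap i.castSucc i.succ) := by
    rw [Equiv.Perm.mclosure_swap_castSucc_succ]
    trivial
  induction hσ using Submonoid.closure_induction with
  | mem x hx =>
    obtain ⟨i, rfl⟩ := hx
    exact antisymm_swap τ z i
  | one =>
    intro I
    have : I.map (1 : Equiv.Perm (Fin (n + 1))).toEmbedding = I := by
      ext r; rw [mem_map_equiv]; rfl
    rw [this]
  | mul x y _ _ hx hy =>
    intro I
    have : I.map (x * y).toEmbedding = (I.map y.toEmbedding).map x.toEmbedding := by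
      rw [map_map]; rfl
    rw [this, hx, hy]

/-- Permutations act transitively on subsets of a given size, and adjacent transpositions generate
them. -/
lemma antisymm_eq_of_card_eq {n : ℕ} (τ : R) (z : Fin (n + 1) → R)
    {I J : Finset (Fin (n + 1))} (h : I.card = J.card) :
    τ ^ (∑ r ∈ I, (r : ℕ)) * antisymm τ z I = τ ^ (∑ r ∈ J, (r : ℕ)) * antisymm τ z J := by
  let e : {x // x ∈ I} ≃ {x // x ∈ J} := I.equivOfCardEq h
  rw [← antisymm_map τ z e.extendSubtype I]
  have : I.map e.extendSubtype.toEmbedding = J := by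
    refine eq_of_subset_of_card_le ?_ (by simp [h])
    intro r hr
    obtain ⟨x, hx, rfl⟩ := mem_map.1 hr
    exact e.extendSubtype_mem x hx
  rw [this]

open Polynomial in
/-- Antisymmetrizing a product of linear factors amounts, up to a linear map, to the
specialization `z_r = τ^(-r) Y`. -/
lemma exists_linearMap_sum_sign {n : ℕ} [Algebra ℂ R] {τ : ℂ} (hτ : τ ≠ 0)
    (z : Fin (n + 1) → R) (w : R) :
    ∃ L : ℂ[X] →ₗ[ℂ] R, ∀ a b : Fin (n + 1) → ℂ,
      ∑ π : Equiv.Perm (Fin (n + 1)), (Equiv.Perm.sign π : ℤ) •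
        (pairProd (algebraMap ℂ R τ) (z ∘ π) * ∏ r, (a r • z (π r) + b r • w)) =
      L (∏ r, (C (a r * (τ ^ (r : ℕ))⁻¹) * Polynomial.X + C (b r))) := by
  -- The image of Y^m, with {r < m} representing the subsets of size m. Only m ≤ n + 1 occurs below,
  -- so the truncated subtraction is harmless.
  set v : ℕ → R := fun m => w ^ (n + 1 - m) *
    (algebraMap ℂ R τ ^ (∑ r with (r : Fin (n + 1)).val < m, (r : ℕ)) *
      antisymm (algebraMap ℂ R τ) z {r | r.val < m}) with hv
  refine ⟨(basisMonomials ℂ).constr ℂ v, fun a b => ?_⟩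
  have hL : ∀ m, (basisMonomials ℂ).constr ℂ v (Polynomial.X ^ m) = v m := by
    intro m
    rw [X_pow_eq_monomial]
    simpa using (basisMonomials ℂ).constr_basis ℂ v m
  have hanti : ∀ I : Finset (Fin (n + 1)), v I.card =
      (∏ r ∈ I, τ ^ (r : ℕ)) • (w ^ (n + 1 - I.card) * antisymm (algebraMap ℂ R τ) z I) := by
    intro I
    have hle : I.card ≤ n + 1 := by simpa using card_le_univ I
    have hc : I.card = (univ.filter fun r : Fin (n + 1) => r.val < I.card).card := by
      simp [Fin.card_filter_val_lt, hle]
    simp only [hv]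
    rw [← antisymm_eq_of_card_eq _ z hc, prod_pow_eq_pow_sum, Algebra.smul_def, map_pow]
    ring
  have hleft : ∀ π : Equiv.Perm (Fin (n + 1)), ∏ r, (a r • z (π r) + b r • w) =
      ∑ I : Finset (Fin (n + 1)), ((∏ r ∈ I, a r) * ∏ r ∈ univ \ I, b r) •
        (w ^ (n + 1 - I.card) * ∏ r ∈ I, z (π r)) := by
    intro π
    rw [prod_add, powerset_univ]
    refine sum_congr rfl fun I _ => ?_
    rw [prod_smul, prod_smul, prod_const, card_univ_sdiff, Fintype.card_fin, smul_mul_smul_comm,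
      mul_comm (w ^ _)]
  have hright : ∏ r, (C (a r * (τ ^ (r : ℕ))⁻¹) * Polynomial.X + C (b r)) =
      ∑ I : Finset (Fin (n + 1)), ((∏ r ∈ I, a r * (τ ^ (r : ℕ))⁻¹) * ∏ r ∈ univ \ I, b r) •
        (Polynomial.X ^ I.card : ℂ[X]) := by
    rw [prod_add, powerset_univ]
    refine sum_congr rfl fun I _ => ?_
    rw [prod_mul_distrib, prod_const, ← map_prod, ← map_prod, smul_eq_C_mul, map_mul]
    ring
  rw [hright, map_sum]
  simp_rw [map_smul, hL, hanti, hleft, mul_sum, smul_sum]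
  rw [sum_comm]
  refine sum_congr rfl fun I _ => ?_
  have hcancel : (∏ r ∈ I, a r * (τ ^ (r : ℕ))⁻¹) * ∏ r ∈ I, τ ^ (r : ℕ) = ∏ r ∈ I, a r := by
    rw [← prod_mul_distrib]
    refine prod_congr rfl fun r _ => ?_
    field_simp
  rw [smul_smul, mul_right_comm, hcancel, antisymm, mul_sum, smul_sum]
  refine sum_congr rfl fun π _ => ?_
  simp only [Algebra.smul_def]
  ring

open Polynomial in
/-- The `q`-Serre identity for Laurent polynomials. -/
lemma serre_identity {N : ℕ} [Algebra ℂ R] {t : ℂ} (ht0 : t ≠ 0) (ht1 : ‖t‖ < 1)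
    (z : Fin (N + 1) → R) (w : R) :
    ∑ π : Equiv.Perm (Fin (N + 1)), ∑ k ∈ range (N + 2),
      ((-1) ^ k * qBinom t (N + 1) k) • ((Equiv.Perm.sign π : ℤ) •
        (pairProd (algebraMap ℂ R (t ^ 2)) (z ∘ π) *
          ∏ r : Fin (N + 1), (if (r : ℕ) < k then (t ^ N)⁻¹ • z (π r) - w
            else z (π r) - (t ^ N)⁻¹ • w))) = 0 := by
  obtain ⟨L, hL⟩ := exists_linearMap_sum_sign (pow_ne_zero 2 ht0) z w
  have h1 : ∀ k ∈ range (N + 2), ∑ π : Equiv.Perm (Fin (N + 1)),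
      ((-1) ^ k * qBinom t (N + 1) k) • ((Equiv.Perm.sign π : ℤ) •
        (pairProd (algebraMap ℂ R (t ^ 2)) (z ∘ π) *
          ∏ r : Fin (N + 1), (if (r : ℕ) < k then (t ^ N)⁻¹ • z (π r) - w
            else z (π r) - (t ^ N)⁻¹ • w))) =
      L (((-1) ^ k * qBinom t (N + 1) k) •
        ∏ r : Fin (N + 1), (C ((if (r : ℕ) < k then (t ^ N)⁻¹ else 1) *
          ((t ^ 2) ^ (r : ℕ))⁻¹) * Polynomial.X +
          C (if (r : ℕ) < k then -1 else -(t ^ N)⁻¹))) := by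
    intro k _
    rw [map_smul, ← hL, ← smul_sum]
    congr 1
    refine sum_congr rfl fun π _ => ?_
    congr 2
    refine prod_congr rfl fun r _ => ?_
    split_ifs <;> simp [sub_eq_add_neg]
  rw [sum_comm, sum_congr rfl h1, ← map_sum]
  convert L.map_zero
  refine Polynomial.funext fun y => ?_
  rw [eval_zero, ← sum_qBinom_prod_eq_zero ht0 ht1 N y, eval_finsetSum]
  refine sum_congr rfl fun k _ => ?_
  rw [eval_smul, eval_prod, smul_eq_mul, prod_range]
  congr 1
  refine prod_congr rfl fun r _ => ?_
  split_ifs <;> simp [pow_mul, sub_eq_add_neg]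

end Antisymmetrization

/-! ### Substituting monomials, geometric series, and cancellation. -/

section OneVariable

variable {M : Type*} [AddCommGroup M] {m : M}

lemma at_apply_zsmul (hm : Injective fun n : ℤ => n • m) (F : FPS ℤ) (n : ℤ) :
    at_ F m (n • m) = F n :=
  hm.extend_apply F 0 n

lemma at_apply_eq_zero (F : FPS ℤ) {p : M} (hp : ∀ n : ℤ, n • m ≠ p) : at_ F m p = 0 :=
  extend_apply' F (0 : M → ℂ) p fun ⟨n, hn⟩ => hp n hn

lemma neg_injective_zsmul (hm : Injective fun n : ℤ => n • m) :
    Injective fun n : ℤ => n • (-m) := fun a b h => hm (by simpa using h)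

lemma at_neg_apply_zsmul (hm : Injective fun n : ℤ => n • m) (F : FPS ℤ) (n : ℤ) :
    at_ F (-m) (n • m) = F (-n) := by
  rw [← at_apply_zsmul (neg_injective_zsmul hm) F (-n)]
  simp

/-- Transports (x - c) H(1/x) = (c x - 1) G(x) to x = X^m; off the multiples of m all terms vanish.
-/
lemma at_relation (hm : Injective fun n : ℤ => n • m) {G H : FPS ℤ} {c : ℂ}
    (h : ∀ k : ℤ, H (1 - k) - c * H (-k) = c * G (k - 1) - G k) (p : M) :
    at_ H (-m) (p - m) - c * at_ H (-m) p = c * at_ G m (p - m) - at_ G m p := by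
  by_cases hp : ∃ n : ℤ, n • m = p
  · obtain ⟨n, rfl⟩ := hp
    have : n • m - m = (n - 1) • m := by rw [sub_smul, one_smul]
    rw [this]
    simp only [at_neg_apply_zsmul hm, at_apply_zsmul hm]
    simpa using h n
  · push Not at hp
    have hp' : ∀ n : ℤ, n • m ≠ p - m := fun n hn => hp (n + 1) (by
      rw [add_smul, hn, one_smul, sub_add_cancel])
    have hn : ∀ r : M, (∀ n : ℤ, n • m ≠ r) → ∀ n : ℤ, n • (-m) ≠ r := fun r hr n h =>
      hr (-n) (by simpa using h)
    rw [at_apply_eq_zero _ hp, at_apply_eq_zero _ hp', at_apply_eq_zero _ (hn _ hp),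
      at_apply_eq_zero _ (hn _ hp')]
    simp

lemma act_geom [DecidableEq M] (hm : Injective fun n : ℤ => n • m) (c : ℂ) :
    act (1 - c • X m) (at_ (geom c) m) = mon 0 := by
  ext p
  have h : act (1 - c • X m) (at_ (geom c) m) p =
      at_ (geom c) m p - c * at_ (geom c) m (p - m) := by
    simp [act_X]
  rw [h]
  by_cases hp : ∃ n : ℤ, n • m = p
  · obtain ⟨n, rfl⟩ := hp
    have e : n • m - m = (n - 1) • m := by rw [sub_smul, one_smul]
    have e0 : n • m = 0 ↔ n = 0 := by
      constructor
      · intro h; exact hm (by simpa using h)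
      · rintro rfl; simp
    rw [e, at_apply_zsmul hm, at_apply_zsmul hm]
    simp only [geom, mon, e0]
    rcases lt_trichotomy n 0 with hn | rfl | hn
    · rw [if_neg (by omega), if_neg (by omega), if_neg (by omega)]; simp
    · simp
    · rw [if_pos (by omega), if_pos (by omega), if_neg (by omega)]
      obtain ⟨k, rfl⟩ : ∃ k : ℕ, n = k + 1 := ⟨(n - 1).toNat, by omega⟩
      rw [show ((k : ℤ) + 1 - 1) = k by ring, ← Int.natCast_succ, zpow_natCast, zpow_natCast,
        pow_succ]
      ring
  · push Not at hp
    have hp' : ∀ n : ℤ, n • m ≠ p - m := fun n hn => hp (n + 1) (by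
      rw [add_smul, hn, one_smul, sub_add_cancel])
    have h0 : p ≠ 0 := fun h => hp 0 (by simp [h])
    rw [at_apply_eq_zero _ hp, at_apply_eq_zero _ hp']
    simp [mon, h0]

lemma summable_geom {c : ℂ} (hc : ‖c‖ < 1) : Summable fun n => ‖geom c n‖ := by
  refine (summable_int_iff_summable_nat_and_neg).2 ⟨?_, ?_⟩
  · simpa [geom] using summable_geometric_of_lt_one (norm_nonneg c) hc
  · refine summable_of_ne_finset_zero (s := {0}) fun n hn => ?_
    have : n ≠ 0 := by simpa using hn
    simp [geom, this]

lemma summable_at_geom (hm : Injective fun n : ℤ => n • m) {c : ℂ} (hc : ‖c‖ < 1) :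
    Summable fun p => ‖at_ (geom c) m p‖ := by
  refine (hm.summable_iff fun p hp => ?_).1 ?_
  · rw [at_apply_eq_zero _ fun n hn => hp ⟨n, hn⟩, norm_zero]
  · refine (summable_geom hc).congr fun n => ?_
    simp [at_apply_zsmul hm]

/-- Any finite set of exponent families lies in a box, where the sum of norms is at most the product
of the ℓ¹ norms. -/
lemma prodExists_of_summable_norm {ι : Type*} [Fintype ι] {f : ι → FPS M}
    (hf : ∀ i, Summable fun p => ‖f i p‖) : ProdExists f := by
  classical
  have h : Summable fun e : ι → M => ‖∏ i, f i (e i)‖ := by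
    refine summable_of_sum_le (c := ∏ i, ∑' p, ‖f i p‖) (fun _ => norm_nonneg _) fun T => ?_
    calc ∑ e ∈ T, ‖∏ i, f i (e i)‖
        ≤ ∑ e ∈ Fintype.piFinset fun i => T.image fun e => e i, ‖∏ i, f i (e i)‖ := by
          refine sum_le_sum_of_subset_of_nonneg (fun e he => ?_) fun _ _ _ => norm_nonneg _
          exact Fintype.mem_piFinset.2 fun i => mem_image_of_mem (fun e => e i) he
      _ = ∏ i, ∑ p ∈ T.image fun e => e i, ‖f i p‖ := by
          rw [prod_univ_sum]
          simp only [norm_prod]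
      _ ≤ ∏ i, ∑' p, ‖f i p‖ :=
          prod_le_prod (fun i _ => sum_nonneg fun _ _ => norm_nonneg _) fun i _ =>
            (hf i).sum_le_tsum _ fun _ _ => norm_nonneg _
  exact fun p => h.of_norm.subtype _

/-- If `S` and `R` are inverse to the Laurent polynomials `L` and `K`, and the product
`S R L K P` exists, then `L P = 0` implies `P = 0`. -/
lemma eq_zero_of_prodExists [DecidableEq M] {S R P : FPS M} {L K : AddMonoidAlgebra ℂ M}
    (hS : act L S = mon 0) (hR : act K R = mon 0) (hP : act L P = 0)
    (h : ProdExists ![S, R, act L (mon 0), act K (mon 0), P]) : P = 0 := by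
  ext p
  let E : M × M × M × M ≃ {e : Fin 5 → M // ∑ i, e i = p} :=
    { toFun := fun x => ⟨![x.1, x.2.1, x.2.2.1, x.2.2.2,
        p - x.1 - x.2.1 - x.2.2.1 - x.2.2.2], by simp [Fin.sum_univ_five]⟩
      invFun := fun e => (e.1 0, e.1 1, e.1 2, e.1 3)
      left_inv := fun x => rfl
      right_inv := fun e => by
        ext i
        have := e.2
        rw [Fin.sum_univ_five] at this
        fin_cases i
        · rfl
        · rfl
        · rfl
        · rfl
        · simp only [← this]
          change _ - _ - _ - _ - _ = e.1 4
          abel }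
  have hT := E.summable_iff.2 (h p)
  set T : M × M × M × M → ℂ := fun x => S x.1 * R x.2.1 * L.coeff x.2.2.1 * K.coeff x.2.2.2 *
    P (p - x.1 - x.2.1 - x.2.2.1 - x.2.2.2)
  have hT' : Summable T := by
    refine hT.congr fun x => ?_
    simp only [comp_apply, Fin.prod_univ_five, act_mon_zero]
    rfl
  -- In the new coordinates the first two entries are the exponents of the products L S and K R.
  let E' : M × M × M × M ≃ M × M × M × M :=
    { toFun := fun x => (x.1 - x.2.2.1, x.2.1 - x.2.2.2, x.2.2.1, x.2.2.2)
      invFun := fun x => (x.1 + x.2.2.1, x.2.1 + x.2.2.2, x.2.2.1, x.2.2.2)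
      left_inv := fun x => by simp
      right_inv := fun x => by simp }
  -- Summing first over the exponents of K, then of L, produces L (K P) = K (L P) = 0.
  have h1 : ∑' x, T x = 0 := by
    rw [hT'.tsum_prod]
    have : ∀ x y z u : M, T (x, y, z, u) =
        S x * R y * L.coeff z * (K.coeff u * P (p - x - y - z - u)) := fun x y z u => by
      simp [T, mul_assoc]
    refine (tsum_congr fun x => ?_).trans tsum_zero
    rw [(hT'.prod_factor x).tsum_prod]
    refine (tsum_congr fun y => ?_).trans tsum_zero
    rw [((hT'.prod_factor x).prod_factor y).tsum_prod]
    simp_rw [this, tsum_mul_left, (act_hasSum K P _).tsum_eq, mul_assoc, tsum_mul_left,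
      (act_hasSum L (act K P) _).tsum_eq]
    rw [← act_mul, mul_comm L K, act_mul, hP]
    simp
  have hT'' := E'.summable_iff.2 hT'
  -- Here the inner sums are K R = 1 and L S = 1.
  have h2 : ∑' x, T x = P p := by
    rw [← E'.tsum_eq]
    refine (Summable.tsum_prod hT'').trans ?_
    have e : ∀ x y z u : M, (T ∘ E') (x, y, z, u) =
        P (p - x - y) * (L.coeff z * S (x - z)) * (K.coeff u * R (y - u)) := fun x y z u => by
      have : p - (x - z) - (y - u) - z - u = p - x - y := by abel
      simp only [T, E', comp_apply, Equiv.coe_fn_mk, this]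
      ring
    have e2 : ∀ x : M, ∑' y : M × M × M, (T ∘ E') (x, y) =
        ∑' y, P (p - x - y) * mon 0 x * mon 0 y := by
      intro x
      refine (Summable.tsum_prod (hT''.prod_factor x)).trans (tsum_congr fun y => ?_)
      refine (Summable.tsum_prod ((hT''.prod_factor x).prod_factor y)).trans ?_
      simp_rw [e, tsum_mul_left, (act_hasSum K R _).tsum_eq, tsum_mul_right, tsum_mul_left,
        (act_hasSum L S _).tsum_eq, hS, hR]
    simp_rw [e2]
    rw [tsum_eq_single 0, tsum_eq_single 0]
    · simp [mon]
    · intro y hy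
      simp [mon, hy]
    · intro x hx
      simp [mon, hx]
  rw [← h2, h1, Pi.zero_apply]

end OneVariable

/-! ### The functional system coefficientwise. -/

section Solutions

/-- The functional system in terms of coefficients. -/
lemma IsSolution.coeff {l : ℕ} {a : Matrix (Fin l) (Fin l) ℤ} {d : Fin l → ℕ} {q : ℂ}
    {F : Fin l → Fin l → FPS ℤ} (hF : IsSolution a d q F) {i j : Fin l} (hij : a i j ≠ 0)
    (k : ℤ) :
    F j i (1 - k) - q ^ symmMatrix a d i j * F j i (-k) =
      q ^ symmMatrix a d i j * F i j (k - 1) - F i j k := by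
  have h := hF i j hij
  simp only at h
  set c : ℂ := q ^ symmMatrix a d i j
  have e1 : (mon (1, 0) - c • mon (0, 1) : FPS (ℤ × ℤ)) =
      act (X (1, 0) - c • X (0, 1)) (mon 0) := by simp [act_X_mon_zero]
  have e2 : (c • mon (1, 0) - mon (0, 1) : FPS (ℤ × ℤ)) =
      act (c • X (1, 0) - X (0, 1)) (mon 0) := by simp [act_X_mon_zero]
  rw [e1, e2, mul_act_mon_zero, mul_act_mon_zero] at h
  have hm : Injective fun n : ℤ => n • (((1, 0) : ℤ × ℤ) - (0, 1)) := fun x y h => by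
    simpa using congrArg Prod.fst h
  -- Both sides are homogeneous of degree one in u, v.
  have h' := congrFun h (k, 1 - k)
  simp only [map_sub, map_smul, LinearMap.sub_apply, LinearMap.smul_apply, Pi.sub_apply,
    Pi.smul_apply, act_X, smul_eq_mul] at h'
  have e3 : ((k, 1 - k) - (1, 0) : ℤ × ℤ) = (k - 1) • (((1, 0) : ℤ × ℤ) - (0, 1)) := by
    ext <;> simp
  have e4 : ((k, 1 - k) - (0, 1) : ℤ × ℤ) = k • (((1, 0) : ℤ × ℤ) - (0, 1)) := by
    ext <;> simp
  rw [e3, e4, ← neg_sub ((1, 0) : ℤ × ℤ) (0, 1)] at h'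
  simp only [at_neg_apply_zsmul hm, at_apply_zsmul hm] at h'
  simpa using h'

end Solutions

/-! ### Pairs of indices under permutations. -/

section Pairs

variable {R : Type*} [CommRing R] {n : ℕ}

/-- Ordered pairs of indices. -/
abbrev Pairs (n : ℕ) := {x : Fin n × Fin n // x.1 < x.2}

lemma prod_pairs_eq_prod_Ioi (h : Fin n → Fin n → R) :
    ∏ x : Pairs n, h x.1.1 x.1.2 = ∏ i, ∏ j ∈ Ioi i, h i j := by
  rw [prod_sigma']
  refine prod_bij' (fun x _ => ⟨x.1.1, x.1.2⟩) (fun y hy => ⟨(y.1, y.2), by simpa using hy⟩)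
    ?_ ?_ ?_ ?_ ?_ <;> simp

lemma prod_pairs_comp_perm (π : Equiv.Perm (Fin n)) {h : Fin n → Fin n → R}
    (hh : ∀ i j, h i j = -h j i) :
    ∏ x : Pairs n, h (π x.1.1) (π x.1.2) =
      (Equiv.Perm.sign π : ℤ) * ∏ x : Pairs n, h x.1.1 x.1.2 := by
  rw [prod_pairs_eq_prod_Ioi, prod_pairs_eq_prod_Ioi fun i j => h (π i) (π j),
    π.prod_Ioi_comp_eq_sign_mul_prod hh]

lemma prod_offDiag_eq_prod_pairs (h : Fin n → Fin n → R) :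
    ∏ x : {x : Fin n × Fin n // x.1 ≠ x.2}, h x.1.1 x.1.2 =
      ∏ x : Pairs n, h x.1.1 x.1.2 * h x.1.2 x.1.1 := by
  rw [prod_mul_distrib]
  have e1 : ∀ P : Fin n × Fin n → Prop, ∀ [DecidablePred P], ∀ g : Fin n × Fin n → R,
      ∏ x : {x // P x}, g x.1 = ∏ x ∈ univ.filter P, g x := fun P _ g =>
    (prod_subtype _ (by simp) g).symm
  rw [e1 (fun x => x.1 ≠ x.2) fun x => h x.1 x.2, e1 (fun x => x.1 < x.2) fun x => h x.1 x.2,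
    e1 (fun x => x.1 < x.2) fun x => h x.2 x.1,
    ← prod_filter_mul_prod_filter_not (univ.filter fun x : Fin n × Fin n => x.1 ≠ x.2)
      (fun x => x.1 < x.2)]
  congr 1
  · refine prod_congr ?_ fun _ _ => rfl
    ext x
    simpa using ne_of_lt
  · refine prod_bij' (fun x _ => x.swap) (fun x _ => x.swap) ?_ ?_ ?_ ?_ ?_
    · intro x hx
      simp only [mem_filter, mem_univ, true_and, Prod.fst_swap, Prod.snd_swap] at hx ⊢
      exact lt_of_le_of_ne (not_lt.1 hx.2) hx.1.symm
    · intro x hx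
      simp only [mem_filter, mem_univ, true_and, Prod.fst_swap, Prod.snd_swap] at hx ⊢
      exact ⟨hx.ne', hx.le.not_gt⟩
    all_goals simp

lemma prod_pairs_comp_perm_eq_prod_offDiag (π : Equiv.Perm (Fin n)) (h : Fin n → Fin n → R) :
    ∏ x : Pairs n, h (π x.1.1) (π x.1.2) * h (π x.1.2) (π x.1.1) =
      ∏ x : {x : Fin n × Fin n // x.1 ≠ x.2}, h x.1.1 x.1.2 := by
  rw [← prod_offDiag_eq_prod_pairs fun i j => h (π i) (π j)]
  exact Equiv.prod_comp ((Equiv.prodCongr π π).subtypeEquiv fun x => by simp)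
    fun x : {x : Fin n × Fin n // x.1 ≠ x.2} => h x.1.1 x.1.2

/-- The action of a permutation on the set of pairs. -/
def sortPair (π : Equiv.Perm (Fin n)) : Pairs n ≃ Pairs n :=
  Equiv.ofBijective
    (fun x => if h : π x.1.1 < π x.1.2 then ⟨(π x.1.1, π x.1.2), h⟩ else
      ⟨(π x.1.2, π x.1.1), lt_of_le_of_ne (not_lt.1 h) fun e => x.2.ne' (π.injective e)⟩)
    (Finite.injective_iff_bijective.1 fun x y hxy => by
      obtain ⟨⟨x1, x2⟩, hx⟩ := x
      obtain ⟨⟨y1, y2⟩, hy⟩ := y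
      simp only at hx hy
      dsimp only at hxy
      split_ifs at hxy <;> simp only [Subtype.mk.injEq, Prod.mk.injEq,
        EmbeddingLike.apply_eq_iff_eq] at hxy ⊢ <;> obtain ⟨rfl, rfl⟩ := hxy
      · simp
      · exact absurd hx hy.asymm
      · exact absurd hx hy.asymm
      · simp)

lemma sortPair_of_lt {π : Equiv.Perm (Fin n)} {x : Pairs n} (h : π x.1.1 < π x.1.2) :
    (sortPair π x).1 = (π x.1.1, π x.1.2) := by
  simp [sortPair, h]

lemma sortPair_of_not_lt {π : Equiv.Perm (Fin n)} {x : Pairs n} (h : ¬π x.1.1 < π x.1.2) :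
    (sortPair π x).1 = (π x.1.2, π x.1.1) := by
  simp [sortPair, h]

/-- Realizes any choice of F_ji on S and F_ij off S by a summand (π, k) with k = |S|. -/
lemma exists_perm_mem_iff (S : Finset (Fin n)) :
    ∃ π : Equiv.Perm (Fin n), ∀ r, π r ∈ S ↔ (r : ℕ) < S.card := by
  have hc : Fintype.card {r : Fin n // (r : ℕ) < S.card} = Fintype.card {r // r ∈ S} := by
    have := card_le_univ S
    simp only [Fintype.card_fin] at this
    rw [Fintype.card_subtype, Fintype.card_coe, Fin.card_filter_val_lt]
    omega
  let e := Fintype.equivOfCardEq hc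
  refine ⟨e.extendSubtype, fun r => ⟨fun h => ?_, fun h => e.extendSubtype_mem r h⟩⟩
  by_contra hr
  exact e.extendSubtype_not_mem r hr h

end Pairs

/-! ### Exponents of z_r/z_p and z_s/w. -/

section Exponents

variable {n : ℕ}

lemma zsmul_injective_of_ne_zero {m : Expo n} (hm : m ≠ 0) : Injective fun k : ℤ => k • m :=
  smul_left_injective ℤ hm

lemma zE_sub_zE_ne_zero {p r : Fin n} (h : p ≠ r) : zE r - zE p ≠ 0 := by
  intro e
  have := congrFun (congrArg Prod.fst e) r
  simp [zE, h.symm] at this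

lemma zE_sub_wE_ne_zero (s : Fin n) : zE s - wE ≠ 0 := by
  intro e
  have := congrArg Prod.snd e
  simp [zE, wE] at this

/-- The exponent of z_s in the total determines the s-th exponent, so at most one term is nonzero.
-/
lemma prodExists_at_zE_sub_wE (F : Fin n → FPS ℤ) :
    ProdExists fun s => at_ (F s) (zE s - wE) := by
  intro p
  refine summable_of_hasFiniteSupport (Set.Subsingleton.finite ?_)
  have key : ∀ e : {e : Fin n → Expo n // ∑ s, e s = p},
      ∏ s, at_ (F s) (zE s - wE) (e.1 s) ≠ 0 → ∀ s, e.1 s = p.1 s • (zE s - wE) := by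
    intro e he
    have h : ∀ s, ∃ k : ℤ, k • (zE s - wE) = e.1 s := by
      intro s
      by_contra! hs
      exact he (prod_eq_zero (mem_univ s) (at_apply_eq_zero _ hs))
    choose k hk using h
    intro s
    have hs : p.1 s = k s := by
      rw [← e.2]
      simp [← hk, zE, wE, Prod.fst_sum, Finset.sum_apply, Pi.single_apply]
    rw [hs, hk]
  intro e he e' he'
  ext1
  funext s
  rw [key e he s, key e' he' s]

end Exponents

/-! ### Normal forms of the factors. -/

section Serre

variable {n : ℕ} (F G H : FPS ℤ)

/-- The factors of a summand of the `q`-Serre combination. -/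
def factors (π : Equiv.Perm (Fin n)) (k : ℕ) : Pairs n ⊕ Fin n → FPS (Expo n)
  | Sum.inl x => at_ F (zE (π x.1.2) - zE (π x.1.1))
  | Sum.inr r => if (r : ℕ) < k then at_ H (wE - zE (π r)) else at_ G (zE (π r) - wE)

/-- `(1 - c z_r / z_p) F(z_r / z_p)`. -/
def edge (c : ℂ) (p r : Fin n) : FPS (Expo n) :=
  act (1 - c • X (zE r - zE p)) (at_ F (zE r - zE p))

variable {F G H}

/-- With x = z_r/z_p, this is (x - c) F(1/x) = (c x - 1) F(x) divided by x. -/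
lemma edge_swap {c : ℂ} (hF : ∀ k : ℤ, F (1 - k) - c * F (-k) = c * F (k - 1) - F k)
    {p r : Fin n} (h : p ≠ r) :
    edge F c r p = act (-X (zE p - zE r)) (edge F c p r) := by
  have hm := zsmul_injective_of_ne_zero (zE_sub_zE_ne_zero h)
  ext e
  have h1 := at_relation hm hF (e + (zE r - zE p))
  rw [neg_sub, add_sub_cancel_right] at h1
  have e1 : e - (zE p - zE r) = e + (zE r - zE p) := by abel
  have e2 : e + (zE r - zE p) - (zE r - zE p) = e := by abel
  simp only [edge, map_sub, map_neg, map_smul, map_one, LinearMap.sub_apply, LinearMap.neg_apply,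
    LinearMap.smul_apply, Module.End.one_apply, Pi.sub_apply, Pi.neg_apply, Pi.smul_apply, act_X,
    smul_eq_mul, e1, e2]
  linear_combination h1

/-- The common quotient of `F_ij(z_s / w)` and `F_ji(w / z_s)`. -/
def spoke (G H : FPS ℤ) (c : ℂ) (s : Fin n) : FPS (Expo n) :=
  (c ^ 2 - 1)⁻¹ • at_ H (wE - zE s) + (-(c * (c ^ 2 - 1)⁻¹)) • at_ G (zE s - wE)

/-- With x = z_s/w and (x - c) H = (c x - 1) G, one finds (c x - 1)(H - c G) = (c² - 1) H and
likewise (x - c)(H - c G) = (c² - 1) G. -/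
lemma act_spoke_left {c : ℂ} (hc : c ^ 2 ≠ 1)
    (hGH : ∀ k : ℤ, H (1 - k) - c * H (-k) = c * G (k - 1) - G k) (s : Fin n) :
    act (X (-wE) * (c • X (zE s) - X wE)) (spoke G H c s) = at_ H (wE - zE s) := by
  have hm := zsmul_injective_of_ne_zero (zE_sub_wE_ne_zero s)
  have hX : X (-wE) * (c • X (zE s) - X wE) = c • X (zE s - wE) - 1 := by
    rw [mul_sub, mul_smul_comm, ← X_add, ← X_add, neg_add_cancel, X_zero, neg_add_eq_sub]
  rw [hX]
  ext e
  have h1 := at_relation hm hGH e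
  rw [neg_sub] at h1
  simp only [spoke, map_sub, map_smul, map_one, LinearMap.sub_apply, LinearMap.smul_apply,
    Module.End.one_apply, Pi.sub_apply, Pi.smul_apply, act_X, smul_eq_mul, Pi.add_apply]
  have hc' : c ^ 2 - 1 ≠ 0 := sub_ne_zero.2 hc
  field_simp
  linear_combination c * h1

lemma act_spoke_right {c : ℂ} (hc : c ^ 2 ≠ 1)
    (hGH : ∀ k : ℤ, H (1 - k) - c * H (-k) = c * G (k - 1) - G k) (s : Fin n) :
    act (X (-wE) * (X (zE s) - c • X wE)) (spoke G H c s) = at_ G (zE s - wE) := by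
  have hm := zsmul_injective_of_ne_zero (zE_sub_wE_ne_zero s)
  have hX : X (-wE) * (X (zE s) - c • X wE) = X (zE s - wE) - c • 1 := by
    rw [mul_sub, mul_smul_comm, ← X_add, ← X_add, neg_add_cancel, X_zero, neg_add_eq_sub]
  rw [hX]
  ext e
  have h1 := at_relation hm hGH e
  rw [neg_sub] at h1
  simp only [spoke, map_sub, map_smul, map_one, LinearMap.sub_apply, LinearMap.smul_apply,
    Module.End.one_apply, Pi.sub_apply, Pi.smul_apply, act_X, smul_eq_mul, Pi.add_apply]
  have hc' : c ^ 2 - 1 ≠ 0 := sub_ne_zero.2 hc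
  field_simp
  linear_combination h1

end Serre

/-! ### The discriminant annihilates the Serre combination. -/

section Main

variable {n : ℕ} {F G H : FPS ℤ}

/-- The sign and the monomial that relate the two orientations of an edge. -/
def edgeSign (p r : Fin n) : AddMonoidAlgebra ℂ (Expo n) :=
  if p < r then X (-zE r) else if r < p then -X (-zE p) else 0

lemma edgeSign_antisymm (p r : Fin n) : edgeSign p r = -edgeSign r p := by
  rcases lt_trichotomy p r with h | rfl | h
  · simp [edgeSign, h, h.asymm]
  · simp [edgeSign]
  · simp [edgeSign, h, h.asymm]

/-- The factors common to all summands. -/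
def commonFactors (F G H : FPS ℤ) (c e : ℂ) : Pairs n ⊕ Fin n → FPS (Expo n)
  | Sum.inl x => edge F c x.1.1 x.1.2
  | Sum.inr s => spoke G H e s

/-- One of the two discriminant factors of the pair turns F into an edge; the other, after
reorienting the edge, becomes z_r - c z_p up to the antisymmetric `edgeSign`. Its product over all
pairs later supplies sign π. -/
lemma act_act_at_eq_act_edge_sortPair {c : ℂ}
    (hF : ∀ k : ℤ, F (1 - k) - c * F (-k) = c * F (k - 1) - F k)
    (π : Equiv.Perm (Fin n)) (x : Pairs n) :
    act ((1 - c • X (zE (π x.1.2) - zE (π x.1.1))) * (1 - c • X (zE (π x.1.1) - zE (π x.1.2))))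
        (at_ F (zE (π x.1.2) - zE (π x.1.1))) =
      act (edgeSign (π x.1.1) (π x.1.2) * (X (zE (π x.1.2)) - c • X (zE (π x.1.1))))
        (edge F c (sortPair π x).1.1 (sortPair π x).1.2) := by
  have hne : π x.1.1 ≠ π x.1.2 := fun h => x.2.ne (π.injective h)
  rw [mul_comm, act_mul, ← edge]
  by_cases h : π x.1.1 < π x.1.2
  · rw [sortPair_of_lt h, edgeSign, if_pos h]
    congr 2
    rw [mul_sub, mul_smul_comm, ← X_add, ← X_add, neg_add_cancel, X_zero, neg_add_eq_sub]
  · have h' : π x.1.2 < π x.1.1 := lt_of_le_of_ne (not_lt.1 h) hne.symm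
    rw [sortPair_of_not_lt h, edgeSign, if_neg h, if_pos h', edge_swap hF hne.symm, ← act_mul]
    congr 2
    simp only [sub_mul, mul_sub, one_mul, neg_mul, mul_neg, smul_mul_assoc, mul_smul_comm,
      ← X_add]
    rw [show zE (π x.1.1) - zE (π x.1.2) + (zE (π x.1.2) - zE (π x.1.1)) = (0 : Expo n) by abel,
      show -zE (π x.1.1) + zE (π x.1.2) = (zE (π x.1.2) - zE (π x.1.1) : Expo n) by abel,
      neg_add_cancel, smul_neg]
    abel

lemma exists_act_at_eq_edge_sortPair {c : ℂ}
    (hF : ∀ k : ℤ, F (1 - k) - c * F (-k) = c * F (k - 1) - F k)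
    (π : Equiv.Perm (Fin n)) (x : Pairs n) :
    ∃ L, act L (at_ F (zE (π x.1.2) - zE (π x.1.1))) =
      edge F c (sortPair π x).1.1 (sortPair π x).1.2 := by
  have hne : π x.1.1 ≠ π x.1.2 := fun h => x.2.ne (π.injective h)
  by_cases h : π x.1.1 < π x.1.2
  · rw [sortPair_of_lt h]
    exact ⟨_, rfl⟩
  · rw [sortPair_of_not_lt h, edge_swap hF hne, edge, ← act_mul]
    exact ⟨_, rfl⟩

/-- Each `spoke` is a combination of the H and G series, so by multilinearity it suffices to treat
every choice of H or G per index. Such a choice comes from a summand of the Serre combination, whose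
product exists by hypothesis and stays so after multiplication by Laurent polynomials. -/
lemma prodExists_commonFactors {c e : ℂ}
    (hF : ∀ k : ℤ, F (1 - k) - c * F (-k) = c * F (k - 1) - F k)
    (hex : ∀ π : Equiv.Perm (Fin n), ∀ k ∈ range (n + 1), ProdExists (factors F G H π k)) :
    ProdExists (commonFactors (n := n) F G H c e) := by
  let f : Pairs n ⊕ Fin n → FPS (Expo n) :=
    Sum.elim (fun x => edge F c x.1.1 x.1.2) fun s => at_ H (wE - zE s)
  let g : Pairs n ⊕ Fin n → FPS (Expo n) :=
    Sum.elim (fun x => edge F c x.1.1 x.1.2) fun s => at_ G (zE s - wE)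
  have hfg : ∀ s : Finset (Pairs n ⊕ Fin n), ProdExists fun i => if i ∈ s then f i else g i := by
    intro s
    let S : Finset (Fin n) := {r | Sum.inr r ∈ s}
    obtain ⟨π, hπ⟩ := exists_perm_mem_iff S
    have hS : S.card ∈ range (n + 1) := by
      have := card_le_univ S
      simp only [Fintype.card_fin] at this
      exact mem_range.2 (by omega)
    choose L hL using exists_act_at_eq_edge_sortPair hF π
    have h := (hex π S.card hS).hasProduct.act (Sum.elim L fun _ => 1)
    refine (HasProduct.reindex (g := act (∏ i, Sum.elim L (fun _ : Fin n => 1) i)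
      (prod (factors F G H π S.card))) (Equiv.sumCongr (sortPair π) π) ?_).prodExists
    convert h using 1
    funext i
    rcases i with x | r
    · simp only [Equiv.sumCongr_apply, Sum.map_inl, Sum.elim_inl, f, g, ite_self, factors, hL]
    · have hr : Sum.inr (π r) ∈ s ↔ (r : ℕ) < S.card := by
        rw [← hπ]
        simp [S]
      simp [f, g, factors, hr]
  convert ProdExists.smul_add_smul hfg (Sum.elim (fun _ => 1) fun _ => (e ^ 2 - 1)⁻¹)
    (Sum.elim (fun _ => 0) fun _ => -(e * (e ^ 2 - 1)⁻¹)) using 1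
  funext i
  rcases i with x | r
  · simp [commonFactors, f, g]
  · simp [commonFactors, f, g, spoke]

/-- The Laurent polynomial `∏_{p ≠ r} (1 - c z_r / z_p)`. -/
def discr (n : ℕ) (c : ℂ) : AddMonoidAlgebra ℂ (Expo n) :=
  ∏ x : {x : Fin n × Fin n // x.1 ≠ x.2}, (1 - c • X (zE x.1.2 - zE x.1.1))

/-- The product of `commonFactors` on the right is independent of π and k, so the Serre sum reduces
to a sum of Laurent polynomial coefficients. -/
lemma act_discr_prod_factors {c e : ℂ} (he : e ^ 2 ≠ 1)
    (hF : ∀ k : ℤ, F (1 - k) - c * F (-k) = c * F (k - 1) - F k)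
    (hGH : ∀ k : ℤ, H (1 - k) - e * H (-k) = e * G (k - 1) - G k)
    (hex : ∀ π : Equiv.Perm (Fin n), ∀ k ∈ range (n + 1), ProdExists (factors F G H π k))
    (π : Equiv.Perm (Fin n)) {k : ℕ} (hk : k ∈ range (n + 1)) :
    act (discr n c) (prod (factors F G H π k)) =
      act (((∏ x : Pairs n, edgeSign x.1.1 x.1.2) * ∏ _r : Fin n, X (-wE)) *
        ((Equiv.Perm.sign π : ℤ) • (pairProd (algebraMap ℂ _ c) ((fun p => X (zE p)) ∘ π) *
          ∏ r : Fin n, (if (r : ℕ) < k then e • X (zE (π r)) - X wE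
            else X (zE (π r)) - e • X wE))))
        (prod (commonFactors F G H c e)) := by
  let L : Pairs n ⊕ Fin n → AddMonoidAlgebra ℂ (Expo n) :=
    Sum.elim (fun x => (1 - c • X (zE (π x.1.2) - zE (π x.1.1))) *
      (1 - c • X (zE (π x.1.1) - zE (π x.1.2)))) fun _ => 1
  let K : Pairs n ⊕ Fin n → AddMonoidAlgebra ℂ (Expo n) :=
    Sum.elim (fun x => edgeSign (π x.1.1) (π x.1.2) *
      (X (zE (π x.1.2)) - c • X (zE (π x.1.1))))
      fun r => X (-wE) * (if (r : ℕ) < k then e • X (zE (π r)) - X wE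
            else X (zE (π r)) - e • X wE)
  have h1 := (hex π k hk).hasProduct.act L
  have h2 : HasProduct (fun i => commonFactors F G H c e (Equiv.sumCongr (sortPair π) π i))
      (prod (commonFactors F G H c e)) := by
    refine HasProduct.reindex (Equiv.sumCongr (sortPair π) π).symm ?_
    simpa using (prodExists_commonFactors hF hex).hasProduct
  have h3 := h2.act K
  have h4 : (fun i => act (L i) (factors F G H π k i)) =
      fun i => act (K i) (commonFactors F G H c e (Equiv.sumCongr (sortPair π) π i)) := by
    funext i
    rcases i with x | r
    · exact act_act_at_eq_act_edge_sortPair hF π x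
    · simp only [L, K, Sum.elim_inr, map_one, Module.End.one_apply, factors, commonFactors,
        Equiv.sumCongr_apply, Sum.map_inr]
      split_ifs
      · rw [act_spoke_left he hGH]
      · rw [act_spoke_right he hGH]
  rw [h4] at h1
  have h5 := h1.unique h3
  have hL : ∏ i, L i = discr n c := by
    rw [Fintype.prod_sum_type]
    simp only [L, Sum.elim_inl, Sum.elim_inr, prod_const_one, mul_one]
    exact prod_pairs_comp_perm_eq_prod_offDiag π fun p r => 1 - c • X (zE r - zE p)
  have hK : ∏ i, K i = ((∏ x : Pairs n, edgeSign x.1.1 x.1.2) * ∏ _r : Fin n, X (-wE)) *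
        ((Equiv.Perm.sign π : ℤ) • (pairProd (algebraMap ℂ _ c) ((fun p => X (zE p)) ∘ π) *
          ∏ r : Fin n, (if (r : ℕ) < k then e • X (zE (π r)) - X wE
            else X (zE (π r)) - e • X wE))) := by
    rw [Fintype.prod_sum_type]
    simp only [K, Sum.elim_inl, Sum.elim_inr, prod_mul_distrib,
      prod_pairs_comp_perm π edgeSign_antisymm, pairProd, zsmul_eq_mul, comp_apply,
      ← Algebra.smul_def]
    ring
  rw [← hL, h5, hK]

/-- The `q`-Serre combination is annihilated by `∏_{p ≠ r} (1 - t² z_r / z_p)`. -/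
lemma act_discr_serre {N : ℕ} (hn : n = N + 1) (hN : N ≠ 0) {t : ℂ} (ht0 : t ≠ 0)
    (ht1 : ‖t‖ < 1)
    (hF : ∀ k : ℤ, F (1 - k) - t ^ 2 * F (-k) = t ^ 2 * F (k - 1) - F k)
    (hGH : ∀ k : ℤ, H (1 - k) - (t ^ N)⁻¹ * H (-k) = (t ^ N)⁻¹ * G (k - 1) - G k)
    (hex : ∀ π : Equiv.Perm (Fin n), ∀ k ∈ range (n + 1), ProdExists (factors F G H π k)) :
    act (discr n (t ^ 2)) (∑ π : Equiv.Perm (Fin n), ∑ k ∈ range (n + 1),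
      ((-1) ^ k * qBinom t n k) • prod (factors F G H π k)) = 0 := by
  subst hn
  -- Needs N ≠ 0, that is a_ij ≠ 0, besides |t| < 1.
  have he : ((t ^ N)⁻¹) ^ 2 ≠ 1 := by
    have := zpow_ne_one_of_norm_lt_one ht1 (k := -((N * 2 : ℕ) : ℤ)) (by simpa using hN)
    rwa [zpow_neg, zpow_natCast, pow_mul, ← inv_pow] at this
  have h : ∀ π : Equiv.Perm (Fin (N + 1)), ∀ k ∈ range (N + 1 + 1),
      act (discr (N + 1) (t ^ 2)) (((-1) ^ k * qBinom t (N + 1) k) • prod (factors F G H π k)) =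
      act (((∏ x : Pairs (N + 1), edgeSign x.1.1 x.1.2) * ∏ _r : Fin (N + 1), X (-wE)) *
        (((-1) ^ k * qBinom t (N + 1) k) • ((Equiv.Perm.sign π : ℤ) •
          (pairProd (algebraMap ℂ _ (t ^ 2)) ((fun p => X (zE p)) ∘ π) *
          ∏ r : Fin (N + 1), (if (r : ℕ) < k then (t ^ N)⁻¹ • X (zE (π r)) - X wE
            else X (zE (π r)) - (t ^ N)⁻¹ • X wE)))))
        (prod (commonFactors F G H (t ^ 2) (t ^ N)⁻¹)) := by
    intro π k hk
    rw [map_smul, act_discr_prod_factors he hF hGH hex π hk,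
      mul_smul_comm ((-1) ^ k * qBinom t (N + 1) k), map_smul act, LinearMap.smul_apply]
  simp only [map_sum]
  rw [sum_congr rfl fun π _ => sum_congr rfl (h π)]
  simp only [← LinearMap.sum_apply, ← map_sum, ← mul_sum]
  rw [serre_identity ht0 ht1 (fun p => X (zE p)) (X wE), mul_zero, map_zero, LinearMap.zero_apply]

lemma serreFactors_eq_factors {l : ℕ} (a : Matrix (Fin l) (Fin l) ℤ)
    (F : Fin l → Fin l → FPS ℤ) (i j : Fin l) (π : Equiv.Perm (Fin (nVars a i j))) (k : ℕ) :
    serreFactors a F i j π k = factors (F i i) (F i j) (F j i) π k := by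
  funext x
  rcases x with x | r <;> rfl

lemma mon_zero_sub_smul_mon (c : ℂ) (m : Expo n) :
    mon 0 - c • mon m = act (1 - c • X m) (mon 0) := by
  simp [act_X_mon_zero]

end Main

end QSerre

end

theorem theorem1 {l : ℕ} (a : Matrix (Fin l) (Fin l) ℤ) (ha : QSerre.IsGenCartan a)
    (d : Fin l → ℕ) (hd : QSerre.IsSymmetrizer a d)
    (q : ℂ) (hq0 : q ≠ 0) (hq1 : ‖q‖ < 1)
    (F : Fin l → Fin l → QSerre.FPS ℤ) (hF : QSerre.IsSolution a d q F)
    (i j : Fin l) (hij : i ≠ j) (haij : a i j ≠ 0)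
    (hP : QSerre.ConstraintProductExists a d q F i j) :
    QSerre.serreP a d q F i j = 0 := by
  open QSerre in
  have hneg : a i j < 0 := lt_of_le_of_ne (ha.nonpos i j hij) haij
  obtain ⟨N, hN⟩ : ∃ N : ℕ, a i j = -(N : ℤ) := ⟨(-a i j).toNat, by omega⟩
  have hN0 : N ≠ 0 := by omega
  have hn : nVars a i j = N + 1 := by simp only [nVars]; omega
  have hd0 : d i ≠ 0 := (hd.pos i).ne'
  have ht0 : q ^ d i ≠ 0 := pow_ne_zero _ hq0
  have ht1 : ‖q ^ d i‖ < 1 := by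
    rw [norm_pow]
    exact pow_lt_one₀ (norm_nonneg q) hq1 hd0
  have hc : q ^ symmMatrix a d i i = (q ^ d i) ^ 2 := by
    rw [symmMatrix, ha.diag, mul_comm, zpow_mul, zpow_natCast]
    norm_cast
  have he : q ^ symmMatrix a d i j = ((q ^ d i) ^ N)⁻¹ := by
    rw [symmMatrix, hN, mul_comm, zpow_mul, zpow_natCast, zpow_neg, zpow_natCast]
  have hFii := hF.coeff (i := i) (j := i) (by rw [ha.diag]; norm_num)
  have hFij := hF.coeff haij
  rw [hc] at hFii
  rw [he] at hFij
  obtain ⟨hex, hprod⟩ := hP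
  have hD : serreD a d q i j = act (discr (nVars a i j) ((q ^ d i) ^ 2)) (mon 0) := by
    simp only [serreD, mon_zero_sub_smul_mon, hc]
    exact prod_act_mon_zero _
  have hE : serreE a d q i j =
      act (∏ s : Fin (nVars a i j), (1 - ((q ^ d i) ^ N)⁻¹ • X (zE s - wE))) (mon 0) := by
    simp only [serreE, mon_zero_sub_smul_mon, he]
    exact prod_act_mon_zero _
  have hS : act (discr (nVars a i j) ((q ^ d i) ^ 2)) (serreS a d q i j) = mon 0 := by
    have hinj : ∀ x : {x : Fin (nVars a i j) × Fin (nVars a i j) // x.1 ≠ x.2},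
        Function.Injective fun k : ℤ => k • (zE x.1.2 - zE x.1.1 : Expo (nVars a i j)) :=
      fun x => zsmul_injective_of_ne_zero (zE_sub_zE_ne_zero x.2)
    have hc1 : ‖(q ^ d i) ^ 2‖ < 1 := by
      rw [norm_pow]
      exact pow_lt_one₀ (norm_nonneg _) ht1 two_ne_zero
    have h := (prodExists_of_summable_norm fun x => summable_at_geom (hinj x) hc1).hasProduct.act
      fun x => 1 - (q ^ d i) ^ 2 • X (zE x.1.2 - zE x.1.1)
    simp only [act_geom (hinj _)] at h
    rw [serreS, hc]
    exact h.unique hasProduct_mon_zero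
  have hR : act (∏ s : Fin (nVars a i j), (1 - ((q ^ d i) ^ N)⁻¹ • X (zE s - wE)))
      (serreR a d q i j) = mon 0 := by
    have h := (prodExists_at_zE_sub_wE (n := nVars a i j)
      fun _ => geom ((q ^ d i) ^ N)⁻¹).hasProduct.act
      fun s => 1 - ((q ^ d i) ^ N)⁻¹ • X (zE s - wE)
    simp only [act_geom (zsmul_injective_of_ne_zero (zE_sub_wE_ne_zero _))] at h
    rw [serreR, he]
    exact h.unique hasProduct_mon_zero
  rw [hD, hE] at hprod
  refine eq_zero_of_prodExists hS hR ?_ hprod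
  simp only [serreP, serreFactors_eq_factors]
  refine act_discr_serre hn hN0 ht0 ht1 hFii hFij fun π k hk => ?_
  rw [← serreFactors_eq_factors]
  exact hex π k hk
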